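/- Let $n,k$ be natural numbers such that $k$ divides $n$, and let $A\in\mathbb{C}^{n\times n}$ be a matrix of rank at most $k$. A matrix $C\in\mathbb{C}^{n\times n}$ is called circulant if there is a vector $c=(c_0,\ldots,c_{n-1})\in\mathbb{C}^n$ with $C_{ij}=c_{(i-j)\bmod n}$ for all $i,j\in\{0,\ldots,n-1\}$. Then for every $\epsilon>0$ there exists a sequence of $4k+1$ matrices $B_1,\ldots,B_{4k+1}\in\mathbb{C}^{n\times n}$, where $B_i$ is circulant if $i$ is odd and diagonal if $i$ is even, such that $\Vert B_1B_2\cdots B_{4k+1}-A\Vert<\epsilon$. Here $\Vert\cdot\Vert$ denotes the operator norm induced by the Euclidean ($\ell_2$) norm on $\mathbb{C}^n$. -/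

import Mathlib

/-- A square matrix is circulant if it is `circ(c)` for some vector `c`, that is, its `(i, j)` entry
is `c (i - j)`, with the difference taken modulo `n`. -/
def IsCirculant {n : ℕ} (M : Matrix (Fin n) (Fin n) ℂ) : Prop :=
  ∃ c : Fin n → ℂ, M = Matrix.circulant c

/-- The operator norm of a matrix with respect to the `ℓ²` norm on `ℂⁿ`. -/
noncomputable def opNorm {n : ℕ} (M : Matrix (Fin n) (Fin n) ℂ) : ℝ :=
  ‖Matrix.toEuclideanCLM (n := Fin n) (𝕜 := ℂ) M‖

open Filter Topology Polynomial

/-! Write `A = U * V` with inner dimension `k`, and let `S` be the stacked identity and `P` the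
cyclic shift. Since `k ∣ n`, `U = X * S` and `Vᵀ = Y * S` with `X`, `Y` of the form `∑ j < k,
diag(dⱼ) Pʲ`, so `A = X * (S * Sᵀ) * Yᵀ` with `S * Sᵀ` circulant. It remains to approximate `X` and
`Y` by products with `k - 1` circulant factors (`shiftPolynomial_mem_closure`).

This works like factoring a polynomial into linear factors: a nonzero "root" `μ` with a nowhere zero
"eigenvector" `w` lets `P - μ` be split off on the right of `X * diag(w)`. Roots come from a
determinant; zeros of `w` are removed by a small perturbation, which is why only a closure is
reached. -/

/-- Products `B₁ ⋯ Bₗ` in which the odd-numbered factors are circulant and the even-numbered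
ones are diagonal. -/
def alternatingProducts (n l : ℕ) : Set (Matrix (Fin n) (Fin n) ℂ) :=
  {M | ∃ B : Fin l → Matrix (Fin n) (Fin n) ℂ,
    (∀ i : Fin l, Odd (i.val + 1) → IsCirculant (B i)) ∧
    (∀ i : Fin l, Even (i.val + 1) → (B i).IsDiag) ∧ (List.ofFn B).prod = M}

theorem alternatingProducts_mul {n l : ℕ} {M N : Matrix (Fin n) (Fin n) ℂ}
    (hM : M ∈ alternatingProducts n l) (hodd : Odd (l + 1) → IsCirculant N)
    (heven : Even (l + 1) → N.IsDiag) : M * N ∈ alternatingProducts n (l + 1) := by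
  obtain ⟨B, h1, h2, h3⟩ := hM
  refine ⟨Fin.snoc B N, fun i => ?_, fun i => ?_, ?_⟩
  · induction i using Fin.lastCases with
    | last => simpa using hodd
    | cast i => simpa using h1 i
  · induction i using Fin.lastCases with
    | last => simpa using heven
    | cast i => simpa using h2 i
  · rw [List.ofFn_succ', List.concat_eq_append, List.prod_append]
    simp [h3]

/-- Products `D₀ C₁ D₁ ⋯ Cₘ Dₘ` with diagonal `Dᵢ` and circulant `Cᵢ`. -/
inductive IsDiagCirculantProduct {n : ℕ} : ℕ → Matrix (Fin n) (Fin n) ℂ → Prop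
  | diag {D : Matrix (Fin n) (Fin n) ℂ} (hD : D.IsDiag) : IsDiagCirculantProduct 0 D
  | mul {m : ℕ} {M C D : Matrix (Fin n) (Fin n) ℂ} (hM : IsDiagCirculantProduct m M)
      (hC : IsCirculant C) (hD : D.IsDiag) : IsDiagCirculantProduct (m + 1) (M * C * D)

theorem IsCirculant.transpose {n : ℕ} {C : Matrix (Fin n) (Fin n) ℂ} (hC : IsCirculant C) :
    IsCirculant C.transpose := by
  obtain ⟨c, rfl⟩ := hC
  rcases n with _ | n
  · exact ⟨c, Subsingleton.elim _ _⟩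
  · exact ⟨_, Matrix.transpose_circulant c⟩

theorem mul_mem_alternatingProducts {n l m : ℕ} (hl : Odd l) {M Z : Matrix (Fin n) (Fin n) ℂ}
    (hM : M ∈ alternatingProducts n l) (hZ : IsDiagCirculantProduct m Z) :
    M * Z ∈ alternatingProducts n (l + 2 * m + 1) := by
  induction hZ with
  | diag hD => exact alternatingProducts_mul hM (fun h => by grind) fun _ => hD
  | @mul m _ _ _ _ hC hD ih =>
    rw [← mul_assoc, ← mul_assoc]
    exact alternatingProducts_mul
      (alternatingProducts_mul ih (fun _ => hC) fun h => by grind)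
      (fun h => by grind) fun _ => hD

theorem mul_transpose_mem_alternatingProducts {n l m : ℕ} (hl : Odd l)
    {M Z : Matrix (Fin n) (Fin n) ℂ}
    (hM : M ∈ alternatingProducts n l) (hZ : IsDiagCirculantProduct m Z) :
    M * Z.transpose ∈ alternatingProducts n (l + 2 * m + 1) := by
  induction hZ generalizing M l with
  | diag hD => exact alternatingProducts_mul hM (fun h => by grind) fun _ => hD.transpose
  | @mul m _ _ _ _ hC hD ih =>
    rw [Matrix.transpose_mul, Matrix.transpose_mul, ← mul_assoc, ← mul_assoc]
    have h := ih (l := l + 2) (by grind) (alternatingProducts_mul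
      (alternatingProducts_mul hM (fun h => by grind) fun _ => hD.transpose)
      (fun _ => hC.transpose) fun h => by grind)
    convert h using 2
    ring

theorem isCirculant_one {n : ℕ} : IsCirculant (1 : Matrix (Fin n) (Fin n) ℂ) := by
  rcases n with _ | n
  · exact ⟨0, Subsingleton.elim _ _⟩
  · exact ⟨_, (Matrix.circulant_single_one ℂ _).symm⟩

/-- `X` and `Y` contribute `2m + 1` factors each, `C` one, and an identity at each end makes the
product start and end with a circulant. -/
theorem mul_mul_transpose_mem_alternatingProducts {n m : ℕ} {X Y C : Matrix (Fin n) (Fin n) ℂ}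
    (hX : IsDiagCirculantProduct m X) (hC : IsCirculant C) (hY : IsDiagCirculantProduct m Y) :
    X * C * Y.transpose ∈ alternatingProducts n (4 * (m + 1) + 1) := by
  have h0 : (1 : Matrix (Fin n) (Fin n) ℂ) ∈ alternatingProducts n 0 :=
    ⟨Fin.elim0, fun i => i.elim0, fun i => i.elim0, by simp⟩
  have h1 : (1 : Matrix (Fin n) (Fin n) ℂ) ∈ alternatingProducts n 1 := by
    simpa using alternatingProducts_mul h0 (fun _ => isCirculant_one) fun h => by grind
  have h2 := alternatingProducts_mul (mul_mem_alternatingProducts (by simp) h1 hX)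
    (fun _ => hC) fun h => by grind
  have h3 := alternatingProducts_mul (mul_transpose_mem_alternatingProducts (by grind) h2 hY)
    (fun _ => isCirculant_one) fun h => by grind
  rw [one_mul, mul_one] at h3
  convert h3 using 2
  ring

/-! ### Singular matrix polynomials and rank factorization -/

/-- A matrix polynomial of positive degree with invertible constant and leading coefficients is
singular at some nonzero point. -/
theorem exists_ne_zero_det_sum_smul_eq_zero {ι : Type*} [Fintype ι] [DecidableEq ι] [Nonempty ι]
    (M : ℕ → Matrix ι ι ℂ) {m : ℕ} (hm : m ≠ 0) (h0 : (M 0).det ≠ 0) (h1 : (M m).det ≠ 0) :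
    ∃ μ : ℂ, μ ≠ 0 ∧ (∑ j ∈ Finset.range (m + 1), μ ^ j • M j).det = 0 := by
  set q : ℂ[X] := (∑ j ∈ Finset.range (m + 1), (X : ℂ[X]) ^ j • (M j).map C).det with hq
  have hev (μ : ℂ) : q.eval μ = (∑ j ∈ Finset.range (m + 1), μ ^ j • M j).det := by
    rw [hq, ← coe_evalRingHom, RingHom.map_det]
    congr 1
    ext a b
    simpa [Matrix.sum_apply] using Finset.sum_congr rfl fun _ _ => mul_comm _ _
  have hz (f : ℕ → ℂ) (hf : ∀ j, f j = (0 : ℂ) ^ j) :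
      ∑ j ∈ Finset.range (m + 1), f j • M j = M 0 := by
    rw [Finset.sum_eq_single 0] <;> simp +contextual [hf]
  have hq0 : q.eval 0 = (M 0).det := by rw [hev, hz _ fun _ => rfl]
  by_cases hd : 0 < q.degree
  · obtain ⟨μ, hμ⟩ := Complex.exists_root hd
    refine ⟨μ, ?_, by rw [← hev]; exact hμ⟩
    rintro rfl
    exact h0 (hq0 ▸ hμ)
  exfalso
  have hconst (μ : ℂ) : (∑ j ∈ Finset.range (m + 1), μ ^ j • M j).det = (M 0).det := by
    rw [← hev, ← hq0, eq_C_of_degree_le_zero (not_lt.mp hd)]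
    simp
  -- If the determinant is constant, substituting `s⁻¹` and clearing denominators determines the
  -- reversed polynomial for `s ≠ 0`, hence by continuity at `0`, where its value is `det (M m)`.
  have key : (fun s : ℂ => (∑ j ∈ Finset.range (m + 1), s ^ (m - j) • M j).det) =
      fun s => (s ^ m) ^ Fintype.card ι * (M 0).det := by
    refine Continuous.ext_on (s := {0}ᶜ) (dense_compl_singleton 0) ?_ (by fun_prop) ?_
    · refine Continuous.matrix_det (continuous_finsetSum _ fun j _ => ?_)
      fun_prop
    · intro s hs
      have hs : s ≠ 0 := hs
      simp only
      rw [← hconst s⁻¹, ← Matrix.det_smul, Finset.smul_sum]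
      congr 1
      refine Finset.sum_congr rfl fun j hj => ?_
      rw [smul_smul, pow_sub₀ _ hs (by grind), inv_pow]
  have := congrFun key 0
  rw [Finset.sum_eq_single m] at this
  · simp [hm] at this
    exact h1 this
  · intro j hj hjm
    rw [zero_pow (by grind), zero_smul]
  · simp

theorem exists_eq_mul_of_rank_le {m n k : ℕ} (A : Matrix (Fin m) (Fin n) ℂ) (hA : A.rank ≤ k) :
    ∃ (U : Matrix (Fin m) (Fin k) ℂ) (V : Matrix (Fin k) (Fin n) ℂ), A = U * V := by
  have hr : Module.finrank ℂ (LinearMap.range A.mulVecLin) ≤ Module.finrank ℂ (Fin k → ℂ) := by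
    rwa [Module.finrank_fin_fun]
  obtain ⟨f, hf⟩ := finrank_le_iff_exists_linearMap.1 hr
  obtain ⟨g, hg⟩ := f.exists_leftInverse_of_injective (LinearMap.ker_eq_bot.2 hf)
  refine ⟨LinearMap.toMatrix' ((LinearMap.range A.mulVecLin).subtype ∘ₗ g),
    LinearMap.toMatrix' (f ∘ₗ A.mulVecLin.rangeRestrict), ?_⟩
  have h : (LinearMap.range A.mulVecLin).subtype ∘ₗ g ∘ₗ f ∘ₗ A.mulVecLin.rangeRestrict =
      A.mulVecLin :=
    LinearMap.ext fun x =>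
      congrArg Subtype.val (LinearMap.congr_fun hg (A.mulVecLin.rangeRestrict x))
  rw [← LinearMap.toMatrix'_comp, LinearMap.comp_assoc, h, ← Matrix.toLin'_apply',
    LinearMap.toMatrix'_toLin']

/-! ### Polynomials in the cyclic shift and their linear factors -/

/-- The cyclic shift `(P w) i = w (i + 1)`. -/
def cyclicShift (n : ℕ) [NeZero n] : Matrix (Fin n) (Fin n) ℂ :=
  Matrix.circulant (Pi.single (-1) 1)

theorem cyclicShift_apply {n : ℕ} [NeZero n] (i l : Fin n) :
    cyclicShift n i l = if l = i + 1 then 1 else 0 := by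
  rw [cyclicShift, Matrix.circulant_apply, Pi.single_apply]
  congr 1
  rw [sub_eq_iff_eq_add, neg_add_eq_sub, eq_sub_iff_add_eq, @eq_comm _ l]

theorem cyclicShift_mul_apply {n : ℕ} [NeZero n] {κ : Type*} (M : Matrix (Fin n) κ ℂ)
    (i : Fin n) (l : κ) : (cyclicShift n * M) i l = M (i + 1) l := by
  simp [Matrix.mul_apply, cyclicShift_apply]

theorem cyclicShift_pow_mul_apply {n : ℕ} [NeZero n] {κ : Type*} (j : ℕ) (M : Matrix (Fin n) κ ℂ)
    (i : Fin n) (l : κ) : (cyclicShift n ^ j * M) i l = M (i + j • 1) l := by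
  induction j generalizing i with
  | zero => simp
  | succ j ih =>
    rw [pow_succ', Matrix.mul_assoc, cyclicShift_mul_apply, ih, succ_nsmul', add_assoc]

theorem cyclicShift_pow_mulVec {n : ℕ} [NeZero n] (j : ℕ) (w : Fin n → ℂ) (i : Fin n) :
    (cyclicShift n ^ j).mulVec w i = w (i + j • 1) := by
  exact cyclicShift_pow_mul_apply j (Matrix.replicateCol Unit w) i ()

theorem cyclicShift_pow_mul_diagonal {n : ℕ} [NeZero n] (j : ℕ) (w : Fin n → ℂ) :
    cyclicShift n ^ j * Matrix.diagonal w =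
      Matrix.diagonal (fun i => w (i + j • 1)) * cyclicShift n ^ j := by
  ext i l
  rw [cyclicShift_pow_mul_apply, Matrix.diagonal_mul, ← mul_one (cyclicShift n ^ j),
    cyclicShift_pow_mul_apply, Matrix.one_apply, Matrix.diagonal_apply]
  split_ifs <;> simp

theorem det_cyclicShift_ne_zero (n : ℕ) [NeZero n] : (cyclicShift n).det ≠ 0 := by
  intro h
  obtain ⟨v, hv, hv0⟩ := Matrix.exists_mulVec_eq_zero_iff.2 h
  refine hv (funext fun i => ?_)
  have := congrFun hv0 (i - 1)
  rw [← pow_one (cyclicShift n), cyclicShift_pow_mulVec] at this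
  simpa using this

theorem isCirculant_cyclicShift_sub_smul {n : ℕ} [NeZero n] (μ : ℂ) :
    IsCirculant (cyclicShift n - μ • 1) := by
  refine ⟨Pi.single (-1) 1 - μ • Pi.single 0 1, ?_⟩
  rw [Matrix.circulant_sub, Matrix.circulant_smul, Matrix.circulant_single_one, cyclicShift]

/-- The polynomial `∑ j ≤ m, diag(dⱼ) Pʲ` in the cyclic shift `P`. -/
noncomputable def shiftPolynomial {n : ℕ} [NeZero n] (d : ℕ → Fin n → ℂ) (m : ℕ) :
    Matrix (Fin n) (Fin n) ℂ :=
  ∑ j ∈ Finset.range (m + 1), Matrix.diagonal (d j) * cyclicShift n ^ j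

theorem shiftPolynomial_mul_apply {n : ℕ} [NeZero n] {κ : Type*} (d : ℕ → Fin n → ℂ) (m : ℕ)
    (M : Matrix (Fin n) κ ℂ) (i : Fin n) (l : κ) :
    (shiftPolynomial d m * M) i l = ∑ j ∈ Finset.range (m + 1), d j i * M (i + j • 1) l := by
  simp only [shiftPolynomial, Matrix.sum_mul, Matrix.sum_apply, Matrix.mul_assoc,
    Matrix.diagonal_mul, cyclicShift_pow_mul_apply]

theorem shiftPolynomial_mul_diagonal {n : ℕ} [NeZero n] (d : ℕ → Fin n → ℂ) (m : ℕ)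
    (w : Fin n → ℂ) : shiftPolynomial d m * Matrix.diagonal w =
      shiftPolynomial (fun j i => d j i * w (i + j • 1)) m := by
  simp only [shiftPolynomial, Finset.sum_mul, Matrix.mul_assoc, cyclicShift_pow_mul_diagonal]
  simp only [← Matrix.mul_assoc, Matrix.diagonal_mul_diagonal]

theorem continuous_shiftPolynomial {n : ℕ} [NeZero n] (m : ℕ) :
    Continuous fun d : ℕ → Fin n → ℂ => shiftPolynomial d m := by
  unfold shiftPolynomial
  fun_prop

/-- Right division by `P - μ`: the quotient coefficients solve `y (j-1) - μ y j = z j`, and the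
remainder is placed in degree `m`. -/
theorem sum_diagonal_mul_pow_mul_sub_smul {n : ℕ} [NeZero n] (z : ℕ → Fin n → ℂ) {μ : ℂ}
    (hμ : μ ≠ 0) (m : ℕ) :
    (∑ j ∈ Finset.range m, Matrix.diagonal
        (fun i => -(μ ^ (j + 1))⁻¹ * ∑ l ∈ Finset.range (j + 1), z l i * μ ^ l) *
          cyclicShift n ^ j) * (cyclicShift n - μ • 1) =
      ∑ j ∈ Finset.range m, Matrix.diagonal (z j) * cyclicShift n ^ j -
        Matrix.diagonal (fun i => (μ ^ m)⁻¹ * ∑ l ∈ Finset.range m, z l i * μ ^ l) *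
          cyclicShift n ^ m := by
  induction m with
  | zero => simp
  | succ m ih =>
    rw [Finset.sum_range_succ, add_mul, ih, Finset.sum_range_succ _ m, mul_assoc, mul_sub,
      ← pow_succ, mul_smul_comm, mul_one]
    set s : ℕ → Fin n → ℂ := fun m i => ∑ l ∈ Finset.range m, z l i * μ ^ l with hs
    have h1 : Matrix.diagonal (fun i => -(μ ^ (m + 1))⁻¹ * s (m + 1) i) =
        -Matrix.diagonal (fun i => (μ ^ (m + 1))⁻¹ * s (m + 1) i) := by
      ext a b
      by_cases h : a = b <;> simp [h]
    have h2 : μ • Matrix.diagonal (fun i => (μ ^ (m + 1))⁻¹ * s (m + 1) i) =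
        Matrix.diagonal (z m) + Matrix.diagonal (fun i => (μ ^ m)⁻¹ * s m i) := by
      rw [← Matrix.diagonal_smul, Matrix.diagonal_add]
      congr 1
      ext i
      simp only [hs, Finset.sum_range_succ, Pi.smul_apply, smul_eq_mul]
      field_simp
      ring
    change _ - Matrix.diagonal (fun i => (μ ^ m)⁻¹ * s m i) * _ +
      Matrix.diagonal (fun i => -(μ ^ (m + 1))⁻¹ * s (m + 1) i) * _ = _ -
      Matrix.diagonal (fun i => (μ ^ (m + 1))⁻¹ * s (m + 1) i) * _
    rw [h1, mul_sub, mul_smul_comm, ← smul_mul_assoc, smul_neg, h2]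
    noncomm_ring

theorem exists_shiftPolynomial_eq_mul {n : ℕ} [NeZero n] (d : ℕ → Fin n → ℂ) (m : ℕ)
    {μ : ℂ} (hμ : μ ≠ 0) {w : Fin n → ℂ} (hw : ∀ i, w i ≠ 0)
    (h : ∀ i, ∑ j ∈ Finset.range (m + 2), d j i * w (i + j • 1) * μ ^ j = 0) :
    ∃ y : ℕ → Fin n → ℂ, shiftPolynomial d (m + 1) =
      shiftPolynomial y m * (cyclicShift n - μ • 1) * Matrix.diagonal fun i => (w i)⁻¹ := by
  refine ⟨fun j i => -(μ ^ (j + 1))⁻¹ *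
    ∑ l ∈ Finset.range (j + 1), d l i * w (i + l • 1) * μ ^ l, ?_⟩
  rw [shiftPolynomial, shiftPolynomial,
    sum_diagonal_mul_pow_mul_sub_smul (fun j i => d j i * w (i + j • 1)) hμ]
  -- By `h`, the remainder of the division is exactly the missing top-degree term.
  have hlast : Matrix.diagonal (fun i => (μ ^ (m + 1))⁻¹ *
      ∑ l ∈ Finset.range (m + 1), d l i * w (i + l • 1) * μ ^ l) =
      -Matrix.diagonal (fun i => d (m + 1) i * w (i + (m + 1) • 1)) := by
    rw [Matrix.diagonal_neg]
    congr 1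
    ext i
    have := h i
    rw [Finset.sum_range_succ] at this
    rw [eq_neg_of_add_eq_zero_left this]
    field_simp
  have hadd := shiftPolynomial_mul_diagonal d (m + 1) w
  rw [shiftPolynomial, shiftPolynomial,
    Finset.sum_range_succ (fun j => Matrix.diagonal (fun i => d j i * w (i + j • 1)) *
      cyclicShift n ^ j)] at hadd
  rw [hlast, neg_mul, sub_neg_eq_add, ← hadd, mul_assoc, Matrix.diagonal_mul_diagonal]
  simp [hw]

theorem exists_ne_zero_sum_mul_pow_eq_zero {n : ℕ} [NeZero n] (d : ℕ → Fin n → ℂ) {m : ℕ}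
    (hm : m ≠ 0) (h0 : ∀ i, d 0 i ≠ 0) (h1 : ∀ i, d m i ≠ 0) :
    ∃ (μ : ℂ) (w : Fin n → ℂ), μ ≠ 0 ∧ w ≠ 0 ∧
      ∀ i, ∑ j ∈ Finset.range (m + 1), d j i * w (i + j • 1) * μ ^ j = 0 := by
  have hdet (j : ℕ) (hj : ∀ i, d j i ≠ 0) :
      (Matrix.diagonal (d j) * cyclicShift n ^ j).det ≠ 0 := by
    rw [Matrix.det_mul, Matrix.det_diagonal, Matrix.det_pow]
    exact mul_ne_zero (Finset.prod_ne_zero_iff.2 fun i _ => hj i)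
      (pow_ne_zero _ (det_cyclicShift_ne_zero n))
  obtain ⟨μ, hμ, hs⟩ := exists_ne_zero_det_sum_smul_eq_zero
    (fun j => Matrix.diagonal (d j) * cyclicShift n ^ j) hm (hdet 0 h0) (hdet m h1)
  obtain ⟨w, hw, hw0⟩ := Matrix.exists_mulVec_eq_zero_iff.2 hs
  refine ⟨μ, w, hμ, hw, fun i => ?_⟩
  refine Eq.trans ?_ (congrFun hw0 i)
  rw [Matrix.sum_mulVec, Finset.sum_apply]
  refine Finset.sum_congr rfl fun j _ => ?_
  rw [Matrix.smul_mulVec, ← Matrix.mulVec_mulVec, Pi.smul_apply, Matrix.mulVec_diagonal,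
    cyclicShift_pow_mulVec, smul_eq_mul, mul_comm]

theorem Fin.val_add_nsmul_one {n : ℕ} [NeZero n] (i : Fin n) (j : ℕ) :
    (i + j • 1).val = (i.val + j) % n := by
  induction j with
  | zero => simp [Nat.mod_eq_of_lt i.isLt]
  | succ j ih =>
    rw [succ_nsmul, ← add_assoc, Fin.val_add, ih, Fin.val_one', Nat.add_mod_mod,
      Nat.mod_add_mod, add_assoc]

/-- A solution of a linear recurrence with nowhere vanishing leading coefficient that vanishes on
a window is zero. -/
theorem exists_ne_zero_of_sum_mul_pow_eq_zero {n : ℕ} [NeZero n] (d : ℕ → Fin n → ℂ) {m : ℕ}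
    {μ : ℂ} (hμ : μ ≠ 0) (h1 : ∀ i, d m i ≠ 0) {w : Fin n → ℂ} (hw : w ≠ 0)
    (h : ∀ i, ∑ j ∈ Finset.range (m + 1), d j i * w (i + j • 1) * μ ^ j = 0) (i : Fin n) :
    ∃ j ∈ Finset.range (m + 1), w (i + j • 1) ≠ 0 := by
  by_contra! hz
  have hall (t : ℕ) : w (i + t • 1) = 0 := by
    induction t using Nat.strong_induction_on with
    | _ t ih =>
      by_cases ht : t ∈ Finset.range (m + 1)
      · exact hz t ht
      obtain ⟨s, rfl⟩ : ∃ s, t = s + m := ⟨t - m, by grind⟩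
      have := h (i + s • 1)
      rw [Finset.sum_range_succ, Finset.sum_eq_zero, zero_add] at this
      · rw [add_assoc, ← add_nsmul] at this
        simpa [h1, hμ] using this
      · intro j hj
        rw [add_assoc, ← add_nsmul, ih (s + j) (by grind)]
        simp
  refine hw (funext fun l => ?_)
  have : i + (n - i.val + l.val) • (1 : Fin n) = l := by
    ext
    rw [Fin.val_add_nsmul_one, show i.val + (n - i.val + l.val) = l.val + n by omega,
      Nat.add_mod_right, Nat.mod_eq_of_lt l.isLt]
  rw [← this, hall, Pi.zero_apply]

/-! ### Approximation by products -/

theorem eventually_forall_add_ne_zero {ι : Type*} [Finite ι] (w : ι → ℂ) :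
    ∀ᶠ t in 𝓝[≠] (0 : ℂ), ∀ i, w i + t ≠ 0 := by
  refine eventually_all.2 fun i => ?_
  by_cases hi : w i = 0
  · filter_upwards [self_mem_nhdsWithin] with t ht
    simpa [hi] using ht
  · refine Filter.Eventually.filter_mono nhdsWithin_le_nhds ?_
    exact (show ContinuousAt (fun t : ℂ => w i + t) 0 by fun_prop).eventually_ne (by simpa using hi)

theorem shiftPolynomial_mem_closure_of_tendsto {n : ℕ} [NeZero n] {m : ℕ}
    {S : Set (Matrix (Fin n) (Fin n) ℂ)} {d : ℕ → Fin n → ℂ} {e : ℂ → ℕ → Fin n → ℂ}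
    (he : Tendsto e (𝓝[≠] 0) (𝓝 d)) (h : ∀ᶠ t in 𝓝[≠] 0, shiftPolynomial (e t) m ∈ closure S) :
    shiftPolynomial d m ∈ closure S :=
  isClosed_closure.mem_of_tendsto (((continuous_shiftPolynomial m).tendsto d).comp he) h

theorem shiftPolynomial_mem_closure {n : ℕ} [NeZero n] (m : ℕ) (d : ℕ → Fin n → ℂ) :
    shiftPolynomial d m ∈ closure {M | IsDiagCirculantProduct m M} := by
  induction m generalizing d with
  | zero =>
    refine subset_closure ?_
    rw [shiftPolynomial]
    simpa using IsDiagCirculantProduct.diag (Matrix.isDiag_diagonal (d 0))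
  | succ m ih =>
    have hfactor (d : ℕ → Fin n → ℂ) {μ : ℂ} (hμ : μ ≠ 0) {w : Fin n → ℂ} (hw : ∀ i, w i ≠ 0)
        (h : ∀ i, ∑ j ∈ Finset.range (m + 2), d j i * w (i + j • 1) * μ ^ j = 0) :
        shiftPolynomial d (m + 1) ∈ closure {M | IsDiagCirculantProduct (m + 1) M} := by
      obtain ⟨y, hy⟩ := exists_shiftPolynomial_eq_mul d m hμ hw h
      rw [hy]
      refine map_mem_closure (f := fun M : Matrix (Fin n) (Fin n) ℂ =>
        M * (cyclicShift n - μ • 1) * Matrix.diagonal fun i => (w i)⁻¹) (by fun_prop) (ih y) ?_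
      exact fun M hM => hM.mul (isCirculant_cyclicShift_sub_smul μ) (Matrix.isDiag_diagonal _)
    have hgeneric (d : ℕ → Fin n → ℂ) (h0 : ∀ i, d 0 i ≠ 0) (h1 : ∀ i, d (m + 1) i ≠ 0) :
        shiftPolynomial d (m + 1) ∈ closure {M | IsDiagCirculantProduct (m + 1) M} := by
      obtain ⟨μ, w, hμ, hw, h⟩ := exists_ne_zero_sum_mul_pow_eq_zero d m.succ_ne_zero h0 h1
      choose J hJ hwJ using exists_ne_zero_of_sum_mul_pow_eq_zero d hμ h1 hw h
      set r : ℂ → Fin n → ℂ := fun t i =>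
        ∑ j ∈ Finset.range (m + 2), d j i * (w (i + j • 1) + t) * μ ^ j with hr
      -- Replace `w` by `w + t`, which has no zeros for small `t ≠ 0`. The defect `r t i` of
      -- equation `i` is absorbed into the one coefficient `d (J i) i`; the correction tends to zero
      -- because `w (i + J i) ≠ 0`.
      refine shiftPolynomial_mem_closure_of_tendsto
        (e := fun t j i => d j i - if j = J i then r t i / ((w (i + J i • 1) + t) * μ ^ J i) else 0)
        ?_ ?_
      · refine Tendsto.mono_left ?_ nhdsWithin_le_nhds
        refine tendsto_pi_nhds.2 fun j => tendsto_pi_nhds.2 fun i => ?_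
        split_ifs with hj
        · have hc : ContinuousAt
              (fun t : ℂ => d j i - r t i / ((w (i + J i • 1) + t) * μ ^ J i)) 0 := by
            have : Continuous fun t => r t i := by
              simp only [hr]
              fun_prop
            refine continuousAt_const.sub (this.continuousAt.div (by fun_prop) ?_)
            simp [hwJ, hμ]
          have hz : r 0 i = 0 := by simpa [hr] using h i
          simpa [ContinuousAt, hz] using hc
        · simp
      · filter_upwards [eventually_forall_add_ne_zero w] with t ht
        refine hfactor _ hμ ht fun i => ?_
        simp only [sub_mul, Finset.sum_sub_distrib, ite_mul, zero_mul]
        rw [Finset.sum_ite_eq', if_pos (hJ i), mul_assoc,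
          div_mul_cancel₀ _ (mul_ne_zero (ht _) (pow_ne_zero _ hμ))]
        exact sub_self _
    refine shiftPolynomial_mem_closure_of_tendsto (e := fun t j i => d j i + t) ?_ ?_
    · refine Tendsto.mono_left ?_ nhdsWithin_le_nhds
      have : Continuous fun (t : ℂ) (j : ℕ) (i : Fin n) => d j i + t := by fun_prop
      simpa using this.tendsto 0
    · filter_upwards [eventually_forall_add_ne_zero (d 0),
        eventually_forall_add_ne_zero (d (m + 1))] with t h0 h1
      exact hgeneric _ h0 h1

/-! ### Stacked identities and the final assembly -/

/-- The `n × k` matrix of stacked identity matrices. -/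
def stackedIdentity (n k : ℕ) : Matrix (Fin n) (Fin k) ℂ :=
  Matrix.of fun i r => if i.val % k = r.val then 1 else 0

theorem isCirculant_stackedIdentity_mul_transpose {n k : ℕ} [NeZero k] (hk : k ∣ n) :
    IsCirculant (stackedIdentity n k * (stackedIdentity n k).transpose) := by
  refine ⟨fun i => if i.val % k = 0 then 1 else 0, ?_⟩
  ext i l
  have h1 : (stackedIdentity n k * (stackedIdentity n k).transpose) i l =
      if l.val % k = i.val % k then 1 else 0 := by
    rw [Matrix.mul_apply, Finset.sum_eq_single ⟨i.val % k, Nat.mod_lt _ (NeZero.pos k)⟩]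
    · simp [stackedIdentity]
    · intro r _ hr
      have : i.val % k ≠ r.val := fun h => hr (Fin.ext h.symm)
      simp [stackedIdentity, this]
    · simp
  rw [h1, Matrix.circulant_apply]
  congr 1
  rw [Fin.val_sub, Nat.mod_mod_of_dvd _ hk, eq_iff_iff]
  change l.val ≡ i.val [MOD k] ↔ _
  rw [← Nat.dvd_iff_mod_eq_zero, ← Int.natCast_dvd_natCast, Nat.modEq_iff_dvd]
  have hkn : (k : ℤ) ∣ n := Int.natCast_dvd_natCast.2 hk
  have : ((n - l.val + i.val : ℕ) : ℤ) = n + (i.val - l.val) := by omega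
  rw [this, Int.dvd_add_right hkn]

/-- Among `i, …, i + k` each residue mod `k + 1` occurs exactly once, and wrapping around mod `n`
preserves residues, so each entry of `U` is picked out by a single coefficient. -/
theorem exists_shiftPolynomial_mul_stackedIdentity {n k : ℕ} [NeZero n] (hk : k + 1 ∣ n)
    (U : Matrix (Fin n) (Fin (k + 1)) ℂ) :
    ∃ d : ℕ → Fin n → ℂ, shiftPolynomial d k * stackedIdentity n (k + 1) = U := by
  refine ⟨fun j i => U i (Fin.ofNat (k + 1) (i.val + j)), ?_⟩
  ext i r
  have hmod (j : ℕ) : (i + j • 1 : Fin n).val % (k + 1) = (i.val + j) % (k + 1) := by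
    rw [Fin.val_add_nsmul_one, Nat.mod_mod_of_dvd _ hk]
  rw [shiftPolynomial_mul_apply]
  simp only [stackedIdentity, Matrix.of_apply, hmod]
  have hi : i.val % (k + 1) < k + 1 := Nat.mod_lt _ k.succ_pos
  have hr := r.isLt
  have h : (i.val + (r.val + (k + 1 - i.val % (k + 1))) % (k + 1)) % (k + 1) = r.val := by
    rw [Nat.add_mod_mod, ← Nat.mod_add_mod,
      show i.val % (k + 1) + (r.val + (k + 1 - i.val % (k + 1))) = r.val + (k + 1) by omega,
      Nat.add_mod_right, Nat.mod_eq_of_lt hr]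
  rw [Finset.sum_eq_single ((r.val + (k + 1 - i.val % (k + 1))) % (k + 1))]
  · rw [if_pos h, mul_one]
    congr 1
    exact Fin.ext h
  · intro j hj hne
    rw [if_neg, mul_zero]
    exact fun hj' => hne (Nat.ModEq.eq_of_lt_of_lt
      (Nat.ModEq.add_left_cancel' i.val (hj'.trans h.symm)) (Finset.mem_range.1 hj)
      (Nat.mod_lt _ k.succ_pos))
  · intro h
    exact absurd (Finset.mem_range.2 (Nat.mod_lt _ k.succ_pos)) h

theorem continuous_opNorm {n : ℕ} : Continuous (opNorm (n := n)) :=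
  continuous_norm.comp (LinearMap.continuous_of_finiteDimensional
    { toFun := Matrix.toEuclideanCLM (n := Fin n) (𝕜 := ℂ)
      map_add' := map_add _
      map_smul' := map_smul _ })

theorem theorem2 (n k : ℕ) (A : Matrix (Fin n) (Fin n) ℂ) (hA : A.rank ≤ k) (hk : k ∣ n)
    (ε : ℝ) (hε : 0 < ε) :
    ∃ B : Fin (4 * k + 1) → Matrix (Fin n) (Fin n) ℂ,
      (∀ i : Fin (4 * k + 1), Odd (i.val + 1) → IsCirculant (B i)) ∧
      (∀ i : Fin (4 * k + 1), Even (i.val + 1) → (B i).IsDiag) ∧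
      opNorm ((List.ofFn B).prod - A) < ε := by
  rcases n.eq_zero_or_pos with rfl | hn
  · refine ⟨fun _ => 0, fun _ _ => ⟨0, Subsingleton.elim _ _⟩, fun _ _ => Matrix.isDiag_zero, ?_⟩
    rw [Subsingleton.elim (_ - A) 0]
    simpa [opNorm] using hε
  have : NeZero n := ⟨hn.ne'⟩
  obtain ⟨k, rfl⟩ := Nat.exists_eq_succ_of_ne_zero (ne_zero_of_dvd_ne_zero hn.ne' hk)
  obtain ⟨U, V, rfl⟩ := exists_eq_mul_of_rank_le A hA
  obtain ⟨d, hd⟩ := exists_shiftPolynomial_mul_stackedIdentity hk U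
  obtain ⟨e, he⟩ := exists_shiftPolynomial_mul_stackedIdentity hk V.transpose
  have hUV : U * V = shiftPolynomial d k *
      (stackedIdentity n (k + 1) * (stackedIdentity n (k + 1)).transpose) *
        (shiftPolynomial e k).transpose := by
    rw [← V.transpose_transpose, ← he, ← hd, Matrix.transpose_mul]
    simp only [Matrix.mul_assoc]
  have hmem : U * V ∈ closure (alternatingProducts n (4 * (k + 1) + 1)) := by
    rw [hUV]
    refine map_mem_closure₂ (f := fun X Y : Matrix (Fin n) (Fin n) ℂ =>
      X * (stackedIdentity n (k + 1) * (stackedIdentity n (k + 1)).transpose) * Y.transpose)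
      (by fun_prop) (shiftPolynomial_mem_closure k d) (shiftPolynomial_mem_closure k e) ?_
    exact fun X hX Y hY => mul_mul_transpose_mem_alternatingProducts hX
      (isCirculant_stackedIdentity_mul_transpose hk) hY
  have hopen : IsOpen {M : Matrix (Fin n) (Fin n) ℂ | opNorm (M - U * V) < ε} :=
    isOpen_lt (continuous_opNorm.comp (by fun_prop)) continuous_const
  obtain ⟨M, hM, B, h1, h2, rfl⟩ := mem_closure_iff.1 hmem _ hopen (by simpa [opNorm] using hε)
  exact ⟨B, h1, h2, hM⟩
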